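/- Let $q$ be a prime power, let $\mathbb F_{q}$ be a field with $q$ elements, and let $M$ be a positive integer with $(M,q)=1$. For $n\ge 1$ let $$b_n=\frac{|\{A\in \mathrm{GL}_n(\mathbb F_q) : A \text{ is semisimple and } A^M=\mathrm{Id}_n\}|}{|\mathrm{GL}_n(\mathbb F_q)|}$$ be the proportion of semisimple $M$-th roots of the identity in $\mathrm{GL}_n(q)=\mathrm{GL}_n(\mathbb F_q)$. Then, as formal power series in $z$ with rational coefficients, $$1+\sum_{n=1}^{\infty} b_n z^n=\prod_{d\mid M}\left(1+\sum_{m=1}^{\infty}\frac{z^{m e(d)}}{|\mathrm{GL}_m(q^{e(d)})|}\right)^{\frac{\phi(d)}{e(d)}},$$ where the product runs over the positive divisors $d$ of $M$, $\phi$ is Euler's totient function, $e(d)$ is the multiplicative order of $q$ in $(\mathbb Z/d\mathbb Z)^\times$ (so $e(d)$ divides $\phi(d)$, and $e(1)=1$), and $\mathrm{GL}_m(q^{e(d)})$ is the general linear group over the field with $q^{e(d)}$ elements. -/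

import Mathlib

open scoped PowerSeries MatrixGroups

noncomputable section

/-- The semisimple `M`-th roots of the identity in `GL_n(K)`: the invertible matrices `A` with
`A ^ M = 1` that act semisimply on `K^n`. -/
def semisimpleRoots (K : Type*) [Field K] (M n : ℕ) : Set (GL (Fin n) K) :=
  {A | A ^ M = 1 ∧
    Module.End.IsSemisimple (Matrix.toLin' (A : Matrix (Fin n) (Fin n) K))}

/-- The proportion of semisimple `M`-th roots of the identity in `GL_n(K)`, for a finite field
`K`. -/
def semisimpleRootProportion (K : Type*) [Field K] (M n : ℕ) : ℚ :=
  (Nat.card (semisimpleRoots K M n) : ℚ) / (Nat.card (GL (Fin n) K) : ℚ)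

/-- The order of `GL_m(p ^ k)`, the general linear group over the field with `p ^ k` elements
(for `k ≠ 0`). -/
def cardGL (p : ℕ) [Fact p.Prime] (k m : ℕ) : ℕ :=
  Nat.card (GL (Fin m) (GaloisField p k))

/-- The multiplicative order of `q` modulo `d`. -/
def multOrder (q d : ℕ) : ℕ := orderOf (q : ZMod d)

/-- `multOrder q d` is the order of `q` in the unit group of `ZMod d`. -/
theorem multOrder_eq {q d : ℕ} (h : q.Coprime d) :
    multOrder q d = orderOf (ZMod.unitOfCoprime q h) := by
  rw [multOrder, ← orderOf_units, ZMod.coe_unitOfCoprime]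

/-- The division `φ(d) / e(d)` of natural numbers is exact. -/
theorem multOrder_dvd_totient {q d : ℕ} (hd : 0 < d) (h : q.Coprime d) :
    multOrder q d ∣ d.totient := by
  have : NeZero d := ⟨hd.ne'⟩
  rw [multOrder_eq h, ← ZMod.card_units_eq_totient]
  exact orderOf_dvd_card

/-- The series `∑_{n ≥ 1} b_n z ^ n`, where `b_n` is the proportion of semisimple `M`-th roots of
the identity in `GL_n(K)`. -/
def semisimpleRootSeries (K : Type*) [Field K] (M : ℕ) : ℚ⟦X⟧ :=
  PowerSeries.mk fun n => if n = 0 then 0 else semisimpleRootProportion K M n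

/-- The series `∑_{m ≥ 1} z ^ (m * e) / |GL_m(p ^ (k * e))|` (for `e ≠ 0`): the coefficient of
`z ^ n` is `1 / |GL_m(p ^ (k * e))|` if `n = m * e` with `m ≥ 1`, and `0` if there is no such
`m`. -/
def invCardGLSeries (p : ℕ) [Fact p.Prime] (k e : ℕ) : ℚ⟦X⟧ :=
  PowerSeries.mk fun n => if n ≠ 0 ∧ e ∣ n then 1 / (cardGL p (k * e) (n / e) : ℚ) else 0

end

open Polynomial Module

/-! For a polynomial P over K put F_P = ∑ #{A ∈ End(K^n) : P(A) = 0} / |GL_n(K)| z^n. As M is prime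
to q, X^M - 1 is separable, so A^M = 1 already forces semisimplicity and the left side is F_P for P
= X^M - 1 (`card_semisimpleRoots`).

F is multiplicative on coprime factors (`annihilatedSeries_mul`): primary decomposition splits A
along a complementary pair of subspaces, and |GL_n| / (|GL_a| |GL_b|) such pairs have dimensions (a,
b).

If f is irreducible of degree e, a solution of f(A) = 0 is an action of the field L = K[X]/(f) on
K^n. There is none unless e ∣ n; otherwise these actions form one conjugacy class with stabilizer
GL_{n/e}(L) (`annihilatedSeries_irreducible`).

Finally X^M - 1 is the product of the Φ_d with d ∣ M, and Φ_d has φ(d)/e(d) irreducible factors, all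
of degree e(d). -/

theorem Nat.card_eq_sum_card_fiber {α β : Type*} [Finite α] [Fintype β] (f : α → β) :
    Nat.card α = ∑ b, Nat.card {a // f a = b} :=
  (Nat.card_congr (Equiv.sigmaFiberEquiv f).symm).trans Nat.card_sigma

/-! ### Polynomials in intertwined endomorphisms -/

section Intertwining

variable {K V W : Type*} [Field K] [AddCommGroup V] [Module K V] [AddCommGroup W] [Module K W]

theorem LinearMap.map_aeval_apply_of_intertwining {A : End K V} {B : End K W} {g : V →ₗ[K] W}
    (h : ∀ x, g (A x) = B (g x)) (P : K[X]) (x : V) : g (aeval A P x) = aeval B P (g x) := by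
  induction P using Polynomial.induction_on' generalizing x with
  | add P Q hP hQ => simp [hP, hQ]
  | monomial n a =>
    have : ∀ x, g ((A ^ n) x) = (B ^ n) (g x) := by
      induction n with
      | zero => simp
      | succ n ih => intro x; simp [pow_succ, ih, h]
    simp [aeval_monomial, this, Algebra.algebraMap_eq_smul_one]

/-- Conjugation by a linear equivalence preserves annihilation by a polynomial. -/
noncomputable def annihilatedCongr (P : K[X]) (e : V ≃ₗ[K] W) :
    {A : End K V // aeval A P = 0} ≃ {B : End K W // aeval B P = 0} :=
  (e.conjAlgEquiv K).toEquiv.subtypeEquiv fun A => by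
    change _ ↔ aeval (e.conjAlgEquiv K A) P = 0
    rw [aeval_algHom_apply (e.conjAlgEquiv K)]
    exact (EmbeddingLike.map_eq_zero_iff (f := e.conjAlgEquiv K)).symm

end Intertwining

/-! ### Primary decomposition and complementary pairs -/

section Complements

variable {K V : Type*} [Field K] [AddCommGroup V] [Module K V] {P Q : K[X]}

/-- Ordered pairs of complementary subspaces. -/
abbrev ComplPair (K V : Type*) [Field K] [AddCommGroup V] [Module K V] :=
  {c : Submodule K V × Submodule K V // IsCompl c.1 c.2}

theorem isCompl_ker_aeval (h : IsCoprime P Q) {A : End K V} (hA : aeval A (P * Q) = 0) :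
    IsCompl (LinearMap.ker (aeval A P)) (LinearMap.ker (aeval A Q)) := by
  refine ⟨disjoint_ker_aeval_of_isCoprime A h, codisjoint_iff.2 ?_⟩
  rw [sup_ker_aeval_eq_ker_aeval_mul_of_coprime A h, hA, LinearMap.ker_zero]

/-- The primary decomposition of an endomorphism annihilated by a product of two coprime
polynomials. -/
noncomputable def kerPair (h : IsCoprime P Q) (A : {A : End K V // aeval A (P * Q) = 0}) : ComplPair K V :=
  ⟨(LinearMap.ker (aeval A.1 P), LinearMap.ker (aeval A.1 Q)), isCompl_ker_aeval h A.2⟩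

theorem map_mem_ker_aeval (A : End K V) (P : K[X]) :
    ∀ x ∈ LinearMap.ker (aeval A P), A x ∈ LinearMap.ker (aeval A P) := fun x hx => by
  rw [LinearMap.mem_ker] at hx ⊢
  rw [← LinearMap.map_aeval_apply_of_intertwining (fun _ => rfl) P x, hx, map_zero]

theorem aeval_restrict_eq_zero (A : End K V) {P : K[X]} {S : Submodule K V}
    (hS : LinearMap.ker (aeval A P) = S) (h : ∀ x ∈ S, A x ∈ S) :
    aeval (A.restrict h) P = 0 := by
  ext x
  have := LinearMap.map_aeval_apply_of_intertwining (A := A.restrict h) (B := A)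
    (g := S.subtype) (fun _ => rfl) P x
  have hx : aeval A P x = 0 := by rw [← LinearMap.mem_ker, hS]; exact x.2
  simpa [hx] using this

theorem le_ker_aeval_of_restrict {A : End K V} {P : K[X]} {S : Submodule K V} {B : End K S}
    (hB : aeval B P = 0) (h : ∀ x : S, A x = B x) : S ≤ LinearMap.ker (aeval A P) := fun x hx => by
  have := LinearMap.map_aeval_apply_of_intertwining (A := B) (B := A)
    (g := S.subtype) (fun x => (h x).symm) P ⟨x, hx⟩
  simpa [hB] using this.symm

theorem IsCompl.eq_of_le_of_disjoint {S T S' T' : Submodule K V} (h : IsCompl S T)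
    (h' : Disjoint S' T') (hS : S ≤ S') (hT : T ≤ T') : S = S' := by
  refine le_antisymm hS fun x hx => ?_
  obtain ⟨s, hs, t, ht, rfl⟩ := Submodule.mem_sup.1 (h.sup_eq_top ▸ Submodule.mem_top : x ∈ S ⊔ T)
  have : t ∈ S' := by simpa using S'.sub_mem hx (hS hs)
  rw [Submodule.disjoint_def.1 h' t this (hT ht), add_zero]
  exact hs

/-- The summands lie in the two kernels, which are disjoint by coprimality; since the summands
already span, the kernels cannot be larger. -/
theorem ker_aeval_ofIsCompl (hPQ : IsCoprime P Q) (c : ComplPair K V)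
    (B : {B : End K c.1.1 // aeval B P = 0}) (C : {C : End K c.1.2 // aeval C Q = 0})
    {A : End K V} (hA₁ : ∀ x : c.1.1, A x = B.1 x) (hA₂ : ∀ x : c.1.2, A x = C.1 x) :
    LinearMap.ker (aeval A P) = c.1.1 ∧ LinearMap.ker (aeval A Q) = c.1.2 := by
  have h₁ := le_ker_aeval_of_restrict B.2 hA₁
  have h₂ := le_ker_aeval_of_restrict C.2 hA₂
  have hd := disjoint_ker_aeval_of_isCoprime A hPQ
  exact ⟨(c.2.eq_of_le_of_disjoint hd h₁ h₂).symm,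
    (c.2.symm.eq_of_le_of_disjoint hd.symm h₂ h₁).symm⟩

/-- Endomorphisms with a prescribed primary decomposition are pairs of endomorphisms of the
summands. -/
noncomputable def kerPairFiberEquiv (h : IsCoprime P Q) (c : ComplPair K V) :
    {A // kerPair h A = c} ≃
      {B : End K c.1.1 // aeval B P = 0} × {C : End K c.1.2 // aeval C Q = 0} where
  toFun A :=
    have h₁ : LinearMap.ker (aeval A.1.1 P) = c.1.1 := congrArg (fun c => c.1.1) A.2
    have h₂ : LinearMap.ker (aeval A.1.1 Q) = c.1.2 := congrArg (fun c => c.1.2) A.2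
    (⟨A.1.1.restrict (h₁ ▸ map_mem_ker_aeval A.1.1 P), aeval_restrict_eq_zero _ h₁ _⟩,
      ⟨A.1.1.restrict (h₂ ▸ map_mem_ker_aeval A.1.1 Q), aeval_restrict_eq_zero _ h₂ _⟩)
  invFun D :=
    have key := ker_aeval_ofIsCompl h c D.1 D.2
      (A := LinearMap.ofIsCompl c.2 (c.1.1.subtype ∘ₗ D.1.1) (c.1.2.subtype ∘ₗ D.2.1))
      (fun x => by simp) (fun x => by simp)
    ⟨⟨LinearMap.ofIsCompl c.2 (c.1.1.subtype ∘ₗ D.1.1) (c.1.2.subtype ∘ₗ D.2.1), by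
      rw [← LinearMap.ker_eq_top, ← sup_ker_aeval_eq_ker_aeval_mul_of_coprime _ h, key.1, key.2,
        c.2.sup_eq_top]⟩, Subtype.ext (Prod.ext key.1 key.2)⟩
  left_inv A := by
    refine Subtype.ext (Subtype.ext ?_)
    exact LinearMap.ofIsCompl_eq c.2 (fun _ => rfl) (fun _ => rfl)
  right_inv D := by
    refine Prod.ext (Subtype.ext ?_) (Subtype.ext ?_)
    · ext x
      simp
    · ext x
      simp

variable {U W : Type*} [AddCommGroup U] [Module K U] [AddCommGroup W] [Module K W]

/-- The images of the two factors under an isomorphism from a product. -/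
noncomputable def imagePair (e : (U × W) ≃ₗ[K] V) : ComplPair K V :=
  ⟨((LinearMap.range (LinearMap.inl K U W)).map e.toLinearMap,
    (LinearMap.range (LinearMap.inr K U W)).map e.toLinearMap),
    LinearMap.isCompl_range_inl_inr.map (Submodule.orderIsoMapComap e)⟩

theorem imagePair_fst (e : (U × W) ≃ₗ[K] V) :
    (imagePair e).1.1 = LinearMap.range (e.toLinearMap ∘ₗ LinearMap.inl K U W) :=
  (LinearMap.range_comp _ _).symm

theorem imagePair_snd (e : (U × W) ≃ₗ[K] V) :
    (imagePair e).1.2 = LinearMap.range (e.toLinearMap ∘ₗ LinearMap.inr K U W) :=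
  (LinearMap.range_comp _ _).symm

/-- Isomorphisms from a product that induce a given decomposition are pairs of isomorphisms. -/
noncomputable def imagePairFiberEquiv (c : ComplPair K V) :
    {e : (U × W) ≃ₗ[K] V // imagePair e = c} ≃ (U ≃ₗ[K] c.1.1) × (W ≃ₗ[K] c.1.2) where
  toFun e :=
    ((LinearEquiv.ofInjective (e.1.toLinearMap ∘ₗ LinearMap.inl K U W)
        (e.1.injective.comp LinearMap.inl_injective)).trans
        (LinearEquiv.ofEq _ _ ((imagePair_fst e.1).symm.trans (congrArg (fun c => c.1.1) e.2))),
      (LinearEquiv.ofInjective (e.1.toLinearMap ∘ₗ LinearMap.inr K U W)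
        (e.1.injective.comp LinearMap.inr_injective)).trans
        (LinearEquiv.ofEq _ _ ((imagePair_snd e.1).symm.trans (congrArg (fun c => c.1.2) e.2))))
  invFun D := ⟨(D.1.prodCongr D.2).trans (Submodule.prodEquivOfIsCompl _ _ c.2), by
    refine Subtype.ext (Prod.ext ?_ ?_)
    · rw [imagePair_fst]
      ext x
      simp only [LinearMap.mem_range, LinearMap.comp_apply, LinearEquiv.coe_coe,
        LinearMap.inl_apply, LinearEquiv.trans_apply, LinearEquiv.prodCongr_apply, map_zero,
        Submodule.coe_prodEquivOfIsCompl', ZeroMemClass.coe_zero, add_zero]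
      exact ⟨fun ⟨y, hy⟩ => hy ▸ (D.1 y).2, fun hx => ⟨D.1.symm ⟨x, hx⟩, by simp⟩⟩
    · rw [imagePair_snd]
      ext x
      simp only [LinearMap.mem_range, LinearMap.comp_apply, LinearEquiv.coe_coe,
        LinearMap.inr_apply, LinearEquiv.trans_apply, LinearEquiv.prodCongr_apply, map_zero,
        Submodule.coe_prodEquivOfIsCompl', ZeroMemClass.coe_zero, zero_add]
      exact ⟨fun ⟨y, hy⟩ => hy ▸ (D.2 y).2, fun hx => ⟨D.2.symm ⟨x, hx⟩, by simp⟩⟩⟩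
  left_inv e := by
    refine Subtype.ext (LinearEquiv.ext fun x => ?_)
    simp [LinearEquiv.prodCongr_apply, ← map_add]
  right_inv D := by
    refine Prod.ext (LinearEquiv.ext fun x => ?_) (LinearEquiv.ext fun x => ?_)
    · ext; simp [LinearEquiv.prodCongr_apply]
    · ext; simp [LinearEquiv.prodCongr_apply]

end Complements

/-! ### Counting over a finite field -/

section Counting

variable {K : Type*} [Field K]

/-- The number of endomorphisms of `K ^ n` annihilated by `P`. -/
noncomputable def annihilatedCount (P : K[X]) (n : ℕ) : ℕ :=
  Nat.card {A : End K (Fin n → K) // aeval A P = 0}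

theorem card_annihilated (P : K[X]) (V : Type*) [AddCommGroup V] [Module K V]
    [Module.Finite K V] :
    Nat.card {A : End K V // aeval A P = 0} = annihilatedCount P (finrank K V) :=
  Nat.card_congr (annihilatedCongr P (LinearEquiv.ofFinrankEq _ _ (by simp)))

variable (K) in
/-- The number of automorphisms of `K ^ n`. -/
noncomputable def autCount (n : ℕ) : ℕ :=
  Nat.card ((Fin n → K) ≃ₗ[K] (Fin n → K))

variable (K) in
theorem card_GL_eq_autCount (n : ℕ) : Nat.card (GL (Fin n) K) = autCount K n :=
  Nat.card_congr (Matrix.GeneralLinearGroup.toLin.trans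
    (LinearMap.GeneralLinearGroup.generalLinearEquiv K (Fin n → K))).toEquiv

theorem card_linearEquiv {V W : Type*} [AddCommGroup V] [Module K V] [AddCommGroup W] [Module K W]
    [Module.Finite K V] [Module.Finite K W] (h : finrank K V = finrank K W) :
    Nat.card (V ≃ₗ[K] W) = autCount K (finrank K V) := by
  let e : V ≃ₗ[K] (Fin (finrank K V) → K) := LinearEquiv.ofFinrankEq _ _ (by simp)
  let f : W ≃ₗ[K] (Fin (finrank K V) → K) := LinearEquiv.ofFinrankEq _ _ (by simp [h])
  exact Nat.card_congr ⟨fun g => (e.symm.trans g).trans f, fun g => (e.trans g).trans f.symm,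
    fun g => by ext; simp, fun g => by ext; simp⟩

theorem card_linearEquiv_eq_zero {V W : Type*} [AddCommGroup V] [Module K V] [AddCommGroup W]
    [Module K W] (h : finrank K V ≠ finrank K W) : Nat.card (V ≃ₗ[K] W) = 0 := by
  have : IsEmpty (V ≃ₗ[K] W) := ⟨fun e => h e.finrank_eq⟩
  exact Nat.card_of_isEmpty

variable [Finite K]

instance finite_linearEquiv {V W : Type*} [AddCommGroup V] [Module K V] [AddCommGroup W]
    [Module K W] [Finite V] [Finite W] : Finite (V ≃ₗ[K] W) :=
  DFunLike.finite _

instance finite_end {V : Type*} [AddCommGroup V] [Module K V] [Finite V] : Finite (End K V) :=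
  DFunLike.finite _

variable (K) in
theorem autCount_ne_zero (n : ℕ) : autCount K n ≠ 0 :=
  have : Nonempty ((Fin n → K) ≃ₗ[K] (Fin n → K)) := ⟨LinearEquiv.refl _ _⟩
  Nat.card_pos.ne'

/-- The number of pairs of complementary subspaces of `K ^ (a + b)` of dimensions `a` and `b`. -/
theorem card_complPair_mul {V : Type*} [AddCommGroup V] [Module K V] [Finite V] (a b : ℕ)
    (hab : a + b = finrank K V) :
    Nat.card {c : ComplPair K V // (finrank K c.1.1, finrank K c.1.2) = (a, b)} *
      (autCount K a * autCount K b) = autCount K (finrank K V) := by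
  classical
  have := Fintype.ofFinite (ComplPair K V)
  -- Isomorphisms K^a × K^b ≃ V are sorted by the images of the factors; a fibre is empty unless the
  -- dimensions are (a, b).
  have h := Nat.card_eq_sum_card_fiber (imagePair : (((Fin a → K) × (Fin b → K)) ≃ₗ[K] V) → _)
  rw [card_linearEquiv (by simp [hab])] at h
  simp only [finrank_prod, finrank_fin_fun, hab] at h
  rw [h, Nat.card_eq_fintype_card, Fintype.card_subtype, ← smul_eq_mul, ← Finset.sum_const,
    Finset.sum_filter]
  refine Finset.sum_congr rfl fun c _ => ?_
  rw [Nat.card_congr (imagePairFiberEquiv c), Nat.card_prod]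
  split_ifs with hc
  · obtain ⟨h₁, h₂⟩ := Prod.mk.inj hc
    rw [card_linearEquiv (by simp [h₁]), card_linearEquiv (by simp [h₂])]
    simp
  · by_cases h₁ : finrank K c.1.1 = a
    · have h₂ : finrank K c.1.2 ≠ b := fun h₂ => hc (by rw [h₁, h₂])
      rw [card_linearEquiv_eq_zero (W := c.1.2) (by simpa using h₂.symm), mul_zero]
    · rw [card_linearEquiv_eq_zero (W := c.1.1) (by simpa using Ne.symm h₁), zero_mul]

theorem annihilatedCount_mul {P Q : K[X]} (h : IsCoprime P Q) (n : ℕ) :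
    (annihilatedCount (P * Q) n : ℚ) / autCount K n =
      ∑ x ∈ Finset.HasAntidiagonal.antidiagonal n, (annihilatedCount P x.1 : ℚ) / autCount K x.1 *
        (annihilatedCount Q x.2 / autCount K x.2) := by
  classical
  have := Fintype.ofFinite (ComplPair K (Fin n → K))
  have hsum : annihilatedCount (P * Q) n = ∑ x ∈ Finset.HasAntidiagonal.antidiagonal n,
      Nat.card {c : ComplPair K (Fin n → K) // (finrank K c.1.1, finrank K c.1.2) = x} *
        (annihilatedCount P x.1 * annihilatedCount Q x.2) := by
    -- Sort endomorphisms by their pair of kernels, then the pairs by dimensions.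
    rw [annihilatedCount, Nat.card_eq_sum_card_fiber (kerPair h),
      ← Finset.sum_fiberwise_of_maps_to (t := Finset.HasAntidiagonal.antidiagonal n)
        (g := fun c : ComplPair K (Fin n → K) => (finrank K c.1.1, finrank K c.1.2))]
    · refine Finset.sum_congr rfl fun x _ => ?_
      rw [Nat.card_eq_fintype_card, Fintype.card_subtype]
      refine Finset.sum_const_nat fun c hc => ?_
      rw [Nat.card_congr (kerPairFiberEquiv h c), Nat.card_prod, card_annihilated,
        card_annihilated, ← (Finset.mem_filter.1 hc).2]
    · intro c _
      rw [Finset.HasAntidiagonal.mem_antidiagonal, Submodule.finrank_add_eq_of_isCompl c.2, finrank_fin_fun]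
  rw [hsum, Nat.cast_sum, Finset.sum_div]
  refine Finset.sum_congr rfl fun x hx => ?_
  have hx' : x.1 + x.2 = finrank K (Fin n → K) := by simpa using hx
  have hc := card_complPair_mul x.1 x.2 hx'
  rw [finrank_fin_fun] at hc
  have h0 := autCount_ne_zero K n
  have h1 : (autCount K x.1 : ℚ) ≠ 0 := by exact_mod_cast autCount_ne_zero K x.1
  have h2 : (autCount K x.2 : ℚ) ≠ 0 := by exact_mod_cast autCount_ne_zero K x.2
  have h0' : (autCount K n : ℚ) ≠ 0 := by exact_mod_cast h0
  rw [div_mul_div_comm, div_eq_div_iff h0' (mul_ne_zero h1 h2), ← hc]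
  push_cast
  ring

end Counting

/-! ### Actions of an extension field -/

section FieldExtension

variable {K L V : Type*} [Field K] [Field L] [Algebra K L] [AddCommGroup V] [Module K V]

/-- The `L`-vector space structure defined by an algebra homomorphism `L →ₐ[K] Module.End K V`. -/
abbrev AlgHom.endModule (φ : L →ₐ[K] Module.End K V) : Module L V :=
  Module.compHom V φ.toRingHom

theorem AlgHom.endModule_smul (φ : L →ₐ[K] Module.End K V) (l : L) (v : V) :
    letI := φ.endModule
    l • v = φ l v := rfl

theorem AlgHom.endModule_isScalarTower (φ : L →ₐ[K] Module.End K V) :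
    letI := φ.endModule
    IsScalarTower K L V :=
  letI := φ.endModule
  ⟨fun k l v => by
    rw [φ.endModule_smul, φ.endModule_smul, map_smul, LinearMap.smul_apply]⟩

/-- The action of `L` transported along a `K`-linear equivalence. -/
noncomputable def transportAction {U : Type*} [AddCommGroup U] [Module K U] [Module L U]
    [IsScalarTower K L U] (e : U ≃ₗ[K] V) : L →ₐ[K] Module.End K V :=
  (e.conjAlgEquiv K).toAlgHom.comp (Algebra.lsmul K K U)

theorem transportAction_apply {U : Type*} [AddCommGroup U] [Module K U] [Module L U]
    [IsScalarTower K L U] (e : U ≃ₗ[K] V) (l : L) (v : V) :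
    transportAction e l v = e (l • e.symm v) := rfl

/-- The `K`-linear equivalences that transport a given `L`-action to `φ` are the `L`-linear
ones. -/
def transportActionFiberEquiv {U : Type*} [AddCommGroup U] [Module K U] [Module L U]
    [IsScalarTower K L U] (φ : L →ₐ[K] Module.End K V) :
    letI := φ.endModule
    {e : U ≃ₗ[K] V // transportAction e = φ} ≃ (U ≃ₗ[L] V) :=
  letI := φ.endModule
  haveI := φ.endModule_isScalarTower
  { toFun e := { e.1 with
      map_smul' l u := by
        have : e.1 (l • u) = φ l (e.1 u) := by
          rw [← DFunLike.congr_fun e.2 l, transportAction_apply, LinearEquiv.symm_apply_apply]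
        exact this }
    invFun e := ⟨e.restrictScalars K, by
      ext l v
      rw [transportAction_apply]
      simp [φ.endModule_smul]⟩
    left_inv e := rfl
    right_inv e := rfl }

theorem finrank_dvd_of_algHom_end [Module.Finite K V] (φ : L →ₐ[K] Module.End K V) :
    finrank K L ∣ finrank K V := by
  let := φ.endModule
  have := φ.endModule_isScalarTower
  exact ⟨_, (finrank_mul_finrank K L V).symm⟩

/-- Orbit counting: each K-isomorphism L^m ≃ V transports the L-action to V, and the fibre over an
action is the set of L-linear isomorphisms. Every fibre has |GL_m(L)| elements, since dim_L V = m
for any action. -/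
theorem card_algHom_end_mul [Finite L] [Finite V] {m : ℕ}
    (h : finrank K V = m * finrank K L) :
    Nat.card (L →ₐ[K] Module.End K V) * autCount L m = autCount K (finrank K V) := by
  have : Finite K := Finite.of_injective _ (algebraMap K L).injective
  have : Module.Finite K L := Module.Finite.of_finite
  have : Finite (L →ₐ[K] Module.End K V) := DFunLike.finite _
  have := Fintype.ofFinite (L →ₐ[K] Module.End K V)
  have hU : finrank K (Fin m → L) = finrank K V := by simp [h, finrank_pi_fintype]
  rw [← hU, ← card_linearEquiv hU, Nat.card_eq_sum_card_fiber (transportAction (L := L)),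
    Nat.card_eq_fintype_card, ← Finset.card_univ, ← smul_eq_mul, ← Finset.sum_const]
  refine Finset.sum_congr rfl fun φ _ => ?_
  let := φ.endModule
  have := φ.endModule_isScalarTower
  have : Module.Finite L V := Module.Finite.of_finite
  have hm : finrank L (Fin m → L) = finrank L V := by
    have := finrank_mul_finrank K L V
    rw [h, mul_comm] at this
    rw [finrank_fin_fun]
    exact (Nat.eq_of_mul_eq_mul_right finrank_pos this).symm
  rw [Nat.card_congr (transportActionFiberEquiv φ), card_linearEquiv hm, finrank_fin_fun]

theorem autCount_eq_of_card_eq (F F' : Type*) [Field F] [Field F'] [Finite F] [Finite F']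
    (h : Nat.card F = Nat.card F') (m : ℕ) : autCount F m = autCount F' m := by
  have := Fintype.ofFinite F
  have := Fintype.ofFinite F'
  rw [← card_GL_eq_autCount, ← card_GL_eq_autCount, Matrix.card_GL_field, Matrix.card_GL_field]
  simp only [← Nat.card_eq_fintype_card, h]

/-- Elements annihilated by `f` are algebra homomorphisms out of `K[X] / (f)`. -/
noncomputable def annihilatedEquivAlgHom (f : K[X]) (A : Type*) [Ring A] [Algebra K A] :
    {a : A // aeval a f = 0} ≃ (AdjoinRoot f →ₐ[K] A) where
  toFun a := Ideal.Quotient.liftₐ _ (aeval a.1) fun g hg => by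
    obtain ⟨h, rfl⟩ := Ideal.mem_span_singleton.1 hg
    rw [map_mul, a.2, zero_mul]
  invFun φ := ⟨φ (AdjoinRoot.root f), by
    rw [aeval_algHom_apply, AdjoinRoot.aeval_eq, AdjoinRoot.mk_self, map_zero]⟩
  left_inv a := Subtype.ext (aeval_X a.1)
  right_inv φ := AdjoinRoot.algHom_ext (aeval_X _)

end FieldExtension

/-! ### Generating functions of annihilated endomorphisms -/

section GeneratingFunction

variable {K : Type*} [Field K]

/-- The generating function of the proportions of the matrices annihilated by `P`. -/
noncomputable def annihilatedSeries (P : K[X]) : ℚ⟦X⟧ :=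
  PowerSeries.mk fun n => (annihilatedCount P n : ℚ) / autCount K n

theorem annihilatedCount_zero (P : K[X]) : annihilatedCount P 0 = 1 := by
  have : Subsingleton (End K (Fin 0 → K)) := inferInstance
  rw [annihilatedCount, Nat.card_eq_one_iff_unique]
  exact ⟨inferInstance, ⟨⟨0, Subsingleton.elim _ _⟩⟩⟩

variable (K) in
theorem autCount_zero : autCount K 0 = 1 := by
  rw [autCount, Nat.card_eq_one_iff_unique]
  exact ⟨inferInstance, ⟨LinearEquiv.refl _ _⟩⟩

theorem annihilatedSeries_one : annihilatedSeries (1 : K[X]) = 1 := by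
  ext n
  rw [annihilatedSeries, PowerSeries.coeff_mk, PowerSeries.coeff_one]
  split_ifs with hn
  · subst hn
    rw [annihilatedCount_zero, autCount_zero, Nat.cast_one, div_one]
  · have : NeZero n := ⟨hn⟩
    have : IsEmpty {A : End K (Fin n → K) // aeval A (1 : K[X]) = 0} :=
      ⟨fun A => one_ne_zero ((map_one (aeval A.1)).symm.trans A.2)⟩
    rw [annihilatedCount, Nat.card_of_isEmpty, Nat.cast_zero, zero_div]

variable [Finite K]

theorem annihilatedSeries_mul {P Q : K[X]} (h : IsCoprime P Q) :
    annihilatedSeries (P * Q) = annihilatedSeries P * annihilatedSeries Q := by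
  ext n
  rw [PowerSeries.coeff_mul]
  simp only [annihilatedSeries, PowerSeries.coeff_mk]
  exact annihilatedCount_mul h n

theorem annihilatedSeries_prod {ι : Type*} (s : Finset ι) (f : ι → K[X])
    (h : (∏ i ∈ s, f i).Separable) :
    annihilatedSeries (∏ i ∈ s, f i) = ∏ i ∈ s, annihilatedSeries (f i) := by
  classical
  induction s using Finset.induction_on with
  | empty => simpa using annihilatedSeries_one
  | insert a s ha ih =>
    rw [Finset.prod_insert ha] at h ⊢
    rw [Finset.prod_insert ha, annihilatedSeries_mul h.isCoprime, ih h.of_mul_right]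

theorem annihilatedSeries_irreducible (p k : ℕ) [Fact p.Prime] (hk : k ≠ 0)
    (hK : Nat.card K = p ^ k) {f : K[X]} (hf : Irreducible f) :
    annihilatedSeries f = 1 + invCardGLSeries p k f.natDegree := by
  have := Fact.mk hf
  have : Module.Finite K (AdjoinRoot f) := (AdjoinRoot.powerBasis hf.ne_zero).finite
  have : Finite (AdjoinRoot f) := Module.finite_of_finite K
  have hfr : finrank K (AdjoinRoot f) = f.natDegree := by
    rw [(AdjoinRoot.powerBasis hf.ne_zero).finrank, AdjoinRoot.powerBasis_dim]
  have hcard : Nat.card (AdjoinRoot f) = Nat.card (GaloisField p (k * f.natDegree)) := by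
    rw [GaloisField.card _ _ (mul_ne_zero hk hf.natDegree_pos.ne'),
      Module.natCard_eq_pow_finrank (K := K), hK, hfr, pow_mul]
  ext n
  rw [annihilatedSeries, invCardGLSeries, map_add, PowerSeries.coeff_mk, PowerSeries.coeff_mk,
    PowerSeries.coeff_one]
  by_cases hn : n = 0
  · subst hn
    simp [annihilatedCount_zero, autCount_zero]
  · rw [if_neg hn, zero_add, annihilatedCount,
      Nat.card_congr (annihilatedEquivAlgHom f (End K (Fin n → K)))]
    split_ifs with h
    · have hm := card_algHom_end_mul (K := K) (L := AdjoinRoot f) (V := Fin n → K)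
        (m := n / f.natDegree) (by rw [hfr, finrank_fin_fun, Nat.div_mul_cancel h.2])
      rw [finrank_fin_fun, autCount_eq_of_card_eq _ _ hcard] at hm
      have h0 : (autCount K n : ℚ) ≠ 0 := by exact_mod_cast autCount_ne_zero K n
      have h1 : (autCount (GaloisField p (k * f.natDegree)) (n / f.natDegree) : ℚ) ≠ 0 := by
        exact_mod_cast autCount_ne_zero _ _
      rw [cardGL, card_GL_eq_autCount, div_eq_div_iff h0 h1, one_mul]
      exact_mod_cast hm
    · have : IsEmpty (AdjoinRoot f →ₐ[K] Module.End K (Fin n → K)) :=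
        ⟨fun φ => h ⟨hn, by simpa [hfr] using finrank_dvd_of_algHom_end φ⟩⟩
      rw [Nat.card_of_isEmpty, Nat.cast_zero, zero_div]

end GeneratingFunction

/-! ### Cyclotomic factors -/

section Cyclotomic

variable {K : Type*} [Field K] [Finite K]

theorem annihilatedSeries_cyclotomic (p k : ℕ) [Fact p.Prime] (hk : k ≠ 0)
    (hK : Nat.card K = p ^ k) {d : ℕ} (hd : p.Coprime d) (hsep : (cyclotomic d K).Separable) :
    annihilatedSeries (cyclotomic d K) =
      (1 + invCardGLSeries p k (multOrder (p ^ k) d)) ^ (d.totient / multOrder (p ^ k) d) := by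
  classical
  have := Fintype.ofFinite K
  rw [Nat.card_eq_fintype_card] at hK
  have hprod : ∏ f ∈ (UniqueFactorizationMonoid.normalizedFactors (cyclotomic d K)).toFinset, f =
      cyclotomic d K := by
    -- Separability makes the irreducible factors distinct, so passing from the multiset to a finset
    -- loses nothing.
    rw [Finset.prod_eq_multiset_prod, Multiset.map_id', Multiset.toFinset_val,
      ((UniqueFactorizationMonoid.squarefree_iff_nodup_normalizedFactors
        (cyclotomic_ne_zero d K)).1 hsep.squarefree).dedup,
      UniqueFactorizationMonoid.prod_normalizedFactors_eq (cyclotomic_ne_zero d K),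
      (cyclotomic.monic d K).normalize_eq_self]
  rw [← hprod] at hsep
  have h := annihilatedSeries_prod _ _ hsep
  rw [hprod] at h
  rw [h, multOrder_eq (hd.pow_left k), ← normalizedFactors_cyclotomic_card hK hd,
    ← Finset.prod_const]
  refine Finset.prod_congr rfl fun f hf => ?_
  have hf' := Multiset.mem_toFinset.1 hf
  rw [annihilatedSeries_irreducible p k hk (by rw [Nat.card_eq_fintype_card, hK])
    (UniqueFactorizationMonoid.irreducible_of_normalized_factor f hf'),
    natDegree_of_mem_normalizedFactors_cyclotomic hK hd hf']

end Cyclotomic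

/-! ### Semisimple roots of the identity and the product formula -/

theorem card_semisimpleRoots {K : Type*} [Field K] {M : ℕ} (hM : (X ^ M - 1 : K[X]).Separable) (hM0 : M ≠ 0) (n : ℕ) :
    Nat.card (semisimpleRoots K M n) = annihilatedCount (X ^ M - 1 : K[X]) n := by
  have hiff (B : Matrix (Fin n) (Fin n) K) :
      aeval (Matrix.toLin' B) (X ^ M - 1 : K[X]) = 0 ↔ B ^ M = 1 := by
    rw [map_sub, map_pow, aeval_X, map_one, sub_eq_zero, ← Matrix.toLin'_pow,
      show (1 : End K (Fin n → K)) = Matrix.toLin' 1 from Matrix.toLin'_one.symm,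
      EmbeddingLike.apply_eq_iff_eq]
  refine Nat.card_congr (Equiv.ofBijective
    (fun A => ⟨Matrix.toLin' A.1.1, (hiff _).2 (by rw [← Units.val_pow_eq_pow_val, A.2.1]; rfl)⟩)
    ⟨fun A B h => ?_, fun B => ?_⟩)
  · exact Subtype.ext (Units.ext (Matrix.toLin'.injective (congrArg Subtype.val h)))
  · have hB : (LinearMap.toMatrix' B.1) ^ M = 1 := (hiff _).1 (by rw [Matrix.toLin'_toMatrix', B.2])
    -- Invertibility comes for free from B^M = 1 with M ≠ 0.
    refine ⟨⟨Units.ofPowEqOne _ M hB hM0, Units.ext (by simp), ?_⟩, ?_⟩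
    · rw [Units.val_ofPowEqOne, Matrix.toLin'_toMatrix']
      exact End.isSemisimple_of_squarefree_aeval_eq_zero hM.squarefree B.2
    · exact Subtype.ext (Matrix.toLin'_toMatrix' _)

theorem mainTheorem6 (p k q : ℕ) [Fact p.Prime] (hk : k ≠ 0) (hq : q = p ^ k)
    (K : Type*) [Field K] [Finite K] (hK : Nat.card K = q)
    (M : ℕ) (hM : M.Coprime q) :
    1 + semisimpleRootSeries K M =
      ∏ d ∈ M.divisors,
        (1 + invCardGLSeries p k (multOrder q d)) ^ (d.totient / multOrder q d) := by
  subst hq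
  have hMp : p.Coprime M := ((Nat.coprime_pow_right_iff (Nat.pos_of_ne_zero hk) _ _).1 hM).symm
  -- M = 0 would be coprime to p only if p = 1.
  have hM0 : M ≠ 0 := by
    rintro rfl
    exact (Fact.out : p.Prime).one_lt.ne' ((Nat.coprime_zero_right p).1 hMp)
  have : CharP K p := by
    have := Fintype.ofFinite K
    exact charP_of_card_eq_prime_pow (Nat.card_eq_fintype_card.symm.trans hK)
  have hsep : (X ^ M - 1 : K[X]).Separable := by
    simpa using separable_X_pow_sub_C' p M (1 : K)
      (((Fact.out : p.Prime).coprime_iff_not_dvd).1 hMp) one_ne_zero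
  have hprod := prod_cyclotomic_eq_X_pow_sub_one (Nat.pos_of_ne_zero hM0) K
  have hlhs : 1 + semisimpleRootSeries K M = annihilatedSeries (X ^ M - 1 : K[X]) := by
    ext n
    rw [semisimpleRootSeries, annihilatedSeries, map_add, PowerSeries.coeff_one,
      PowerSeries.coeff_mk, PowerSeries.coeff_mk]
    split_ifs with hn
    · subst hn
      simp [annihilatedCount_zero, autCount_zero]
    · rw [zero_add, semisimpleRootProportion, card_semisimpleRoots hsep hM0, card_GL_eq_autCount]
  rw [hlhs, ← hprod, annihilatedSeries_prod _ _ (hprod ▸ hsep)]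
  refine Finset.prod_congr rfl fun d hd => ?_
  have hdM := Nat.dvd_of_mem_divisors hd
  exact annihilatedSeries_cyclotomic p k hk hK (hMp.coprime_dvd_right hdM)
    (hsep.of_dvd (hprod ▸ Finset.dvd_prod_of_mem _ hd))
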